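/- Let $Z_1,Z_2,\dots$ be i.i.d. integer-valued random variables with distribution $q_k=\mathbb P(Z_n=k)$, $k\in\mathbb Z$, such that $\mathbb E\,Z_1^+<\infty$ and $\mathbb P(Z_1<0)>0$. Let $\beta\in(0,1)$, $\gamma<0$ and $I=[\gamma,0)$. Consider the surplus process with $x_0=x\in\mathbb Z$, $x_{n+1}=x_n-a_n+Z_{n+1}$ if $x_n\ge 0$ and $x_{n+1}=x_n$ if $x_n<0$, where the dividend $a_n\in A(x_n)$ is chosen by a history-dependent policy $\pi=(\pi_k)_{k\ge 0}$, that is, $a_k=\pi_k(x_0,a_0,\dots,x_{k-1},a_{k-1},x_k)$, and $A(x)=\{0,\dots,x\}$ for $x\ge 0$, $A(x)=\{0\}$ for $x<0$. For $x\in\mathbb Z$ and $\theta<0$ put $$J_\pi(x,\theta)=\mathbb E_x^\pi\exp\Big\{\theta\sum_{k=0}^\infty\beta^k a_k\Big\},\qquad J(x,\theta)=\inf_\pi J_\pi(x,\theta),$$ the infimum being over all history-dependent policies, and for $x\ge 0$ put $$G(x,\theta)=\sum_{k=-x}^{\infty}J(x+k,\theta)\,q_k+\sum_{k=-\infty}^{-x-1}q_k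 .$$ For $\theta\in I$ and $x\ge 0$ let $f^*(x,\theta)$ be the largest minimiser of $a\mapsto e^{\theta a}G(x-a,\theta\beta)$ over $a\in\{0,\dots,x\}$, and let $f^*(x,\theta)=0$ for $x<0$. Let $$\xi(\theta)=\sup\{x\in\mathbb N_0: f^*(x,\theta)=0\}\in\mathbb N_0\cup\{\infty\}.$$ Then $\sup_{\theta\in I}\xi(\theta)<\infty$, and for every $\theta\in I$ and every integer $x>\xi(\theta)$, $$f^*(x,\theta)=x-\xi(\theta).$$ -/

import Mathlib

open MeasureTheory
open scoped ENNReal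

namespace Dividend

noncomputable section

/-- The set `A(x)` of dividends available in surplus `x`: it is `{0, …, x}` for `x ≥ 0`
and `{0}` for `x < 0`. -/
def actions (x : ℤ) : Finset ℕ := Finset.range (x.toNat + 1)

/-- The set `D` of admissible pairs `(x, a)` with `a ∈ A(x)`. -/
abbrev Admissible : Type := (x : ℤ) × (actions x)

/-- A history-dependent policy: a (deterministic) map which assigns to the history
`(x₀, a₀, …, xₖ₋₁, aₖ₋₁) ∈ D ^ k` (a list of length `k`, in chronological order) and the present
surplus `xₖ` a dividend in `A(xₖ)`. As the list has arbitrary length `k`, this is the same as a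
sequence of maps `πₖ` on `D ^ k × ℤ`. -/
def Policy : Type := List Admissible → (x : ℤ) → actions x

/-- One step of the surplus: `x - a + z` before ruin, and the surplus is frozen after ruin. -/
def step (x : ℤ) (a : ℕ) (z : ℤ) : ℤ := if 0 ≤ x then x - a + z else x

/-- The history up to (excluding) time `n` and the surplus at time `n`, under the policy `π` from
the initial surplus `x`; `z n` is the income between the times `n` and `n + 1`. -/
def run (π : Policy) (x : ℤ) (z : ℕ → ℤ) : ℕ → List Admissible × ℤ
  | 0 => ([], x)
  | n + 1 =>
    ((run π x z n).1 ++ [⟨(run π x z n).2, π (run π x z n).1 (run π x z n).2⟩],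
      step (run π x z n).2 (π (run π x z n).1 (run π x z n).2) (z n))

/-- The dividend `aₙ` paid at time `n`. -/
def dividend (π : Policy) (x : ℤ) (z : ℕ → ℤ) (n : ℕ) : ℕ :=
  π (run π x z n).1 (run π x z n).2

/-- The discounted dividends `∑ₖ β ^ k aₖ`, as a sum with values in `[0, ∞]`. -/
def totalDividends (β : ℝ) (π : Policy) (x : ℤ) (z : ℕ → ℤ) : ℝ≥0∞ :=
  ∑' k : ℕ, ENNReal.ofReal (β ^ k) * (dividend π x z k : ℝ≥0∞)

/-- `exp (θ s)` for `s ∈ [0, ∞]` and `θ < 0`, with `exp (-∞) = 0`. -/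
def expScaled (θ : ℝ) (s : ℝ≥0∞) : ℝ := if s = ⊤ then 0 else Real.exp (θ * s.toReal)

/-- The law of an i.i.d. sequence of incomes with distribution `q`. -/
def incomeLaw (q : PMF ℤ) : Measure (ℕ → ℤ) := Measure.infinitePi fun _ => q.toMeasure

/-- `J_π(x, θ)`, the expectation of `exp (θ ∑ₖ β ^ k aₖ)` under `π` from the surplus `x`. -/
def policyValue (q : PMF ℤ) (β : ℝ) (π : Policy) (x : ℤ) (θ : ℝ) : ℝ :=
  ∫ z, expScaled θ (totalDividends β π x z) ∂(incomeLaw q)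

/-- `J(x, θ)`, the infimum of `J_π(x, θ)` over all history-dependent policies. -/
def value (q : PMF ℤ) (β : ℝ) (x : ℤ) (θ : ℝ) : ℝ := ⨅ π : Policy, policyValue q β π x θ

/-- `G(x, θ) = ∑_{k ≥ -x} J(x + k, θ) q_k + ∑_{k < -x} q_k`. -/
def G (q : PMF ℤ) (β : ℝ) (x : ℤ) (θ : ℝ) : ℝ :=
  ∑' k : ℤ, (if -x ≤ k then value q β (x + k) θ else 1) * (q k).toReal

/-- `exp (θ a) G(x - a, θ β)`, which the optimality equation minimises over `a ∈ A(x)`. -/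
def objective (q : PMF ℤ) (β : ℝ) (x : ℤ) (θ : ℝ) (a : ℕ) : ℝ :=
  Real.exp (θ * a) * G q β (x - a) (θ * β)

open Classical in
/-- The minimisers of the right-hand side of the optimality equation. -/
def minimisers (q : PMF ℤ) (β : ℝ) (x : ℤ) (θ : ℝ) : Finset ℕ :=
  (actions x).filter fun a => ∀ b ∈ actions x, objective q β x θ a ≤ objective q β x θ b

theorem minimisers_nonempty (q : PMF ℤ) (β : ℝ) (x : ℤ) (θ : ℝ) :
    (minimisers q β x θ).Nonempty := by
  obtain ⟨a, ha, h⟩ := (actions x).exists_min_image (objective q β x θ)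
    ⟨0, by simp [actions]⟩
  exact ⟨a, by simpa [minimisers, ha] using h⟩

/-- `f*(x, θ)`: the largest minimiser for `x ≥ 0`, and `0` for `x < 0`. -/
def fstar (q : PMF ℤ) (β : ℝ) (x : ℤ) (θ : ℝ) : ℕ :=
  if 0 ≤ x then (minimisers q β x θ).max' (minimisers_nonempty q β x θ) else 0

/-- `ξ(θ) = sup {x ∈ ℕ : f*(x, θ) = 0}`, a priori with values in `ℕ ∪ {∞}`. -/
def xi (q : PMF ℤ) (β θ : ℝ) : ℕ∞ :=
  ⨆ x ∈ {x : ℕ | fstar q β (x : ℤ) θ = 0}, (x : ℕ∞)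

end

end Dividend

namespace Dividend

/-! Write m for the mean of Z⁺. Discounted dividends never exceed x plus the discounted positive
incomes, so Jensen's inequality gives G(x, θ) ≥ exp(θ(x + m/(1-β))) (`exp_le_G`). Since G ≤ 1,
paying out everything is at least as good as paying nothing once x ≥ βm/(1-β)². This threshold is
free of θ, hence bounds ξ uniformly (`xi_le`).

The form of f* is purely combinatorial: the objective factors through intermediate surpluses
(`objective_add`), so x - f*(x) is the largest zero of f* in {0, …, x}. Beyond ξ this zero is ξ
itself. -/

/-! ### Measurability and tangent bounds -/

theorem coe_mem_actions (x : ℤ) (a : actions x) : (a : ℕ) ≤ x.toNat := by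
  have := a.2
  simp only [actions, Finset.mem_range] at this
  omega

/-- Histories are countable, so under the discrete σ-algebra any policy is measurable. -/
theorem measurable_run (π : Policy) (x : ℤ) (n : ℕ) :
    @Measurable (ℕ → ℤ) (List Admissible × ℤ) inferInstance ⊤ (fun z => run π x z n) := by
  let _ : MeasurableSpace (List Admissible × ℤ) := ⊤
  induction n with
  | zero => exact measurable_const
  | succ n ih =>
    let F : (List Admissible × ℤ) × ℤ → List Admissible × ℤ := fun p =>
      (p.1.1 ++ [⟨p.1.2, π p.1.1 p.1.2⟩], step p.1.2 (π p.1.1 p.1.2) p.2)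
    have hF : Measurable F := Measurable.of_discrete
    exact hF.comp (ih.prodMk (measurable_pi_apply n))

theorem measurable_totalDividends (β : ℝ) (π : Policy) (x : ℤ) :
    Measurable (totalDividends β π x) := by
  refine Measurable.tsum fun k => Measurable.const_mul ?_ _
  let _ : MeasurableSpace (List Admissible × ℤ) := ⊤
  have hF : Measurable fun p : List Admissible × ℤ => ((π p.1 p.2 : ℕ) : ℝ≥0∞) :=
    Measurable.of_discrete
  exact hF.comp (measurable_run π x k)

theorem measurable_expScaled (θ : ℝ) : Measurable (expScaled θ) :=
  Measurable.ite (measurableSet_singleton _) measurable_const (by fun_prop)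

theorem expScaled_nonneg (θ : ℝ) (s : ℝ≥0∞) : 0 ≤ expScaled θ s := by
  unfold expScaled
  split_ifs <;> positivity

theorem expScaled_le_one {θ : ℝ} (hθ : θ ≤ 0) (s : ℝ≥0∞) : expScaled θ s ≤ 1 := by
  unfold expScaled
  split_ifs
  · exact zero_le_one
  · exact Real.exp_le_one_iff.2 (mul_nonpos_of_nonpos_of_nonneg hθ ENNReal.toReal_nonneg)

/-- The exponential lies above its tangent at `θ * c`. -/
theorem exp_tangent_le (θ c s : ℝ) :
    Real.exp (θ * c) * (1 + θ * (s - c)) ≤ Real.exp (θ * s) := by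
  have h := Real.add_one_le_exp (θ * (s - c))
  calc Real.exp (θ * c) * (1 + θ * (s - c))
      ≤ Real.exp (θ * c) * Real.exp (θ * (s - c)) := by gcongr; linarith
    _ = Real.exp (θ * s) := by rw [← Real.exp_add]; ring_nf

theorem tangent_le_expScaled {θ : ℝ} (hθ : θ ≤ 0) (c : ℝ) {s u : ℝ≥0∞} (hsu : s ≤ u)
    (hu : u ≠ ⊤) : Real.exp (θ * c) * (1 + θ * (u.toReal - c)) ≤ expScaled θ s := by
  rw [expScaled, if_neg (ne_top_of_le_ne_top hu hsu)]
  refine (exp_tangent_le θ c u.toReal).trans (Real.exp_le_exp.2 ?_)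
  exact mul_le_mul_of_nonpos_left (ENNReal.toReal_mono hu hsu) hθ

instance (q : PMF ℤ) : IsProbabilityMeasure (incomeLaw q) := by
  unfold incomeLaw
  infer_instance

theorem integrable_expScaled_totalDividends (q : PMF ℤ) (β : ℝ) (π : Policy) (x : ℤ) {θ : ℝ}
    (hθ : θ ≤ 0) :
    Integrable (fun z => expScaled θ (totalDividends β π x z)) (incomeLaw q) := by
  refine Integrable.of_bound (C := 1)
    ((measurable_expScaled θ).comp (measurable_totalDividends β π x)).aestronglyMeasurable ?_
  refine Filter.Eventually.of_forall fun z => ?_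
  rw [Real.norm_of_nonneg (expScaled_nonneg _ _)]
  exact expScaled_le_one hθ _

/-! ### Bounds on the discounted dividends -/

/-- The discounted surplus term makes the induction close: a dividend is paid for by the surplus it
removes. -/
theorem sum_dividend_add_le {β : ℝ} (hβ0 : 0 ≤ β) (hβ1 : β ≤ 1) (π : Policy) (x : ℤ)
    (z : ℕ → ℤ) (n : ℕ) :
    ∑ k ∈ Finset.range n, β ^ k * (dividend π x z k : ℝ) + β ^ n * max ((run π x z n).2 : ℝ) 0
      ≤ max (x : ℝ) 0 + ∑ k ∈ Finset.range n, β ^ (k + 1) * max (z k : ℝ) 0 := by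
  induction n with
  | zero => simp [run]
  | succ n ih =>
    have key : β ^ n * (dividend π x z n : ℝ) + β ^ (n + 1) * max ((run π x z (n + 1)).2 : ℝ) 0
        ≤ β ^ n * max ((run π x z n).2 : ℝ) 0 + β ^ (n + 1) * max (z n : ℝ) 0 := by
      have hs : (run π x z (n + 1)).2 = step (run π x z n).2 (dividend π x z n) (z n) := rfl
      have ha : dividend π x z n ≤ (run π x z n).2.toNat := coe_mem_actions _ _
      rw [hs]
      generalize (run π x z n).2 = y at ha ⊢
      generalize dividend π x z n = a at ha ⊢
      rw [pow_succ, mul_assoc, mul_assoc, ← mul_add, ← mul_add]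
      refine mul_le_mul_of_nonneg_left ?_ (pow_nonneg hβ0 n)
      have hz : (0 : ℝ) ≤ max (z n : ℝ) 0 := le_max_right _ _
      unfold step
      split_ifs with hy
      · have hay : (a : ℝ) ≤ y := by
          have : (a : ℤ) ≤ y := by omega
          exact_mod_cast this
        have hy' : (0 : ℝ) ≤ y := by exact_mod_cast hy
        have h1 : max (((y - a + z n : ℤ)) : ℝ) 0 ≤ (y - a) + max (z n : ℝ) 0 := by
          push_cast
          refine max_le ?_ (by linarith)
          linarith [le_max_left (z n : ℝ) 0]
        rw [max_eq_left hy']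
        -- Retaining y - a costs (1 - β)(y - a) ≥ 0 through discounting.
        nlinarith [mul_le_mul_of_nonneg_left h1 hβ0,
          mul_nonneg (sub_nonneg.2 hβ1) (sub_nonneg.2 hay)]
      · have ha0 : a = 0 := by omega
        have hy' : (y : ℝ) ≤ 0 := by exact_mod_cast (not_le.1 hy).le
        rw [max_eq_right hy', ha0]
        simpa using mul_nonneg hβ0 hz
    rw [Finset.sum_range_succ, Finset.sum_range_succ]
    linarith

theorem totalDividends_le {β : ℝ} (hβ0 : 0 ≤ β) (hβ1 : β ≤ 1) (π : Policy) {x : ℤ}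
    (hx : 0 ≤ x) (z : ℕ → ℤ) :
    totalDividends β π x z ≤
      ENNReal.ofReal x + ∑' k, ENNReal.ofReal (β ^ (k + 1)) * ENNReal.ofReal (max (z k : ℝ) 0) := by
  refine ENNReal.tsum_le_of_sum_range_le fun n => ?_
  have hx' : (0 : ℝ) ≤ x := by exact_mod_cast hx
  have h := sum_dividend_add_le hβ0 hβ1 π x z n
  rw [max_eq_left hx'] at h
  have h0 : 0 ≤ β ^ n * max ((run π x z n).2 : ℝ) 0 := by positivity
  calc ∑ k ∈ Finset.range n, ENNReal.ofReal (β ^ k) * (dividend π x z k : ℝ≥0∞)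
      = ENNReal.ofReal (∑ k ∈ Finset.range n, β ^ k * (dividend π x z k : ℝ)) := by
        rw [ENNReal.ofReal_sum_of_nonneg fun k _ => by positivity]
        refine Finset.sum_congr rfl fun k _ => ?_
        rw [ENNReal.ofReal_mul (by positivity), ENNReal.ofReal_natCast]
    _ ≤ ENNReal.ofReal (x + ∑ k ∈ Finset.range n, β ^ (k + 1) * max (z k : ℝ) 0) :=
        ENNReal.ofReal_le_ofReal (by linarith)
    _ = ENNReal.ofReal x
        + ∑ k ∈ Finset.range n, ENNReal.ofReal (β ^ (k + 1)) * ENNReal.ofReal (max (z k : ℝ) 0) := by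
        rw [ENNReal.ofReal_add hx' (Finset.sum_nonneg fun k _ => by positivity),
          ENNReal.ofReal_sum_of_nonneg fun k _ => by positivity]
        congr 1
        refine Finset.sum_congr rfl fun k _ => ?_
        rw [ENNReal.ofReal_mul (by positivity)]
    _ ≤ _ := by gcongr; exact ENNReal.sum_le_tsum _

theorem lintegral_discounted_income {q : PMF ℤ} {β : ℝ} (hβ0 : 0 ≤ β) (hβ1 : β < 1)
    (hq : Integrable (fun k : ℤ => max (k : ℝ) 0) q.toMeasure) :
    ∫⁻ z : ℕ → ℤ, ∑' k, ENNReal.ofReal (β ^ (k + 1)) * ENNReal.ofReal (max (z k : ℝ) 0)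
        ∂(incomeLaw q)
      = ENNReal.ofReal (β / (1 - β) * ∫ k, max (k : ℝ) 0 ∂q.toMeasure) := by
  have hm : Measurable fun k : ℤ => ENNReal.ofReal (max (k : ℝ) 0) := Measurable.of_discrete
  have h1 (k : ℕ) : ∫⁻ z : ℕ → ℤ, ENNReal.ofReal (max (z k : ℝ) 0) ∂(incomeLaw q)
      = ENNReal.ofReal (∫ k, max (k : ℝ) 0 ∂q.toMeasure) := by
    rw [ofReal_integral_eq_lintegral_ofReal hq
      (Filter.Eventually.of_forall fun k => le_max_right _ _)]
    exact (measurePreserving_eval_infinitePi (fun _ : ℕ => q.toMeasure) k).lintegral_comp hm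
  have hs : HasSum (fun k : ℕ => β ^ (k + 1)) (β / (1 - β)) := by
    simpa only [pow_succ', div_eq_mul_inv] using (hasSum_geometric_of_lt_one hβ0 hβ1).mul_left β
  have hmk (k : ℕ) : Measurable fun z : ℕ → ℤ => ENNReal.ofReal (max (z k : ℝ) 0) :=
    hm.comp (measurable_pi_apply k)
  rw [lintegral_tsum fun k => ((hmk k).const_mul _).aemeasurable]
  simp_rw [lintegral_const_mul _ (hmk _), h1]
  rw [ENNReal.tsum_mul_right, ← ENNReal.ofReal_tsum_of_nonneg (fun k => by positivity) hs.summable,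
    hs.tsum_eq, ENNReal.ofReal_mul (div_nonneg hβ0 (by linarith))]

/-- Jensen's inequality for the pathwise bound `u`: the tangent is taken at its mean `c`, so the
linear term integrates to zero. -/
theorem exp_le_policyValue {q : PMF ℤ} {β : ℝ} (hβ0 : 0 ≤ β) (hβ1 : β < 1)
    (hq : Integrable (fun k : ℤ => max (k : ℝ) 0) q.toMeasure) (π : Policy) {x : ℤ}
    (hx : 0 ≤ x) {θ : ℝ} (hθ : θ ≤ 0) :
    Real.exp (θ * (x + β / (1 - β) * ∫ k, max (k : ℝ) 0 ∂q.toMeasure))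
      ≤ policyValue q β π x θ := by
  have hx' : (0 : ℝ) ≤ x := by exact_mod_cast hx
  have hm0 : 0 ≤ ∫ k, max (k : ℝ) 0 ∂q.toMeasure := integral_nonneg fun k => le_max_right _ _
  have hc0 : 0 ≤ β / (1 - β) * ∫ k, max (k : ℝ) 0 ∂q.toMeasure :=
    mul_nonneg (div_nonneg hβ0 (by linarith)) hm0
  let u : (ℕ → ℤ) → ℝ≥0∞ := fun z =>
    ENNReal.ofReal x + ∑' k, ENNReal.ofReal (β ^ (k + 1)) * ENNReal.ofReal (max (z k : ℝ) 0)
  have hu : Measurable u := by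
    have hm : Measurable fun k : ℤ => ENNReal.ofReal (max (k : ℝ) 0) := Measurable.of_discrete
    exact measurable_const.add
      (Measurable.tsum fun k => (hm.comp (measurable_pi_apply k)).const_mul _)
  have hul : ∫⁻ z, u z ∂(incomeLaw q)
      = ENNReal.ofReal (x + β / (1 - β) * ∫ k, max (k : ℝ) 0 ∂q.toMeasure) := by
    rw [lintegral_add_left measurable_const, lintegral_discounted_income hβ0 hβ1 hq,
      lintegral_const, measure_univ, mul_one, ENNReal.ofReal_add hx' hc0]
  have hutop : ∫⁻ z, u z ∂(incomeLaw q) ≠ ⊤ := by rw [hul]; exact ENNReal.ofReal_ne_top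
  have hufin : ∀ᵐ z ∂(incomeLaw q), u z < ⊤ := ae_lt_top hu hutop
  have huint : Integrable (fun z => (u z).toReal) (incomeLaw q) :=
    integrable_toReal_of_lintegral_ne_top hu.aemeasurable hutop
  set c : ℝ := x + β / (1 - β) * ∫ k, max (k : ℝ) 0 ∂q.toMeasure with hc
  have hui : ∫ z, (u z).toReal ∂(incomeLaw q) = c := by
    rw [integral_toReal hu.aemeasurable hufin, hul, ENNReal.toReal_ofReal (add_nonneg hx' hc0)]
  have hint : Integrable (fun z => θ * ((u z).toReal - c)) (incomeLaw q) :=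
    (huint.sub (integrable_const c)).const_mul θ
  calc Real.exp (θ * c)
      = ∫ z, Real.exp (θ * c) * (1 + θ * ((u z).toReal - c)) ∂(incomeLaw q) := by
        rw [integral_const_mul, integral_add (integrable_const _) hint, integral_const_mul,
          integral_sub huint (integrable_const _), hui]
        simp
    _ ≤ policyValue q β π x θ := by
        refine integral_mono_ae (((integrable_const _).add hint).const_mul _)
          (integrable_expScaled_totalDividends q β π x hθ) ?_
        filter_upwards [hufin] with z hz
        exact tangent_le_expScaled hθ c (totalDividends_le hβ0 hβ1.le π hx z) hz.ne

/-! ### Bounds on the value function and G -/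

instance : Nonempty Policy := ⟨fun _ _ => ⟨0, by simp [actions]⟩⟩

theorem policyValue_nonneg (q : PMF ℤ) (β : ℝ) (π : Policy) (x : ℤ) (θ : ℝ) :
    0 ≤ policyValue q β π x θ :=
  integral_nonneg fun _ => expScaled_nonneg _ _

theorem value_nonneg (q : PMF ℤ) (β : ℝ) (x : ℤ) (θ : ℝ) : 0 ≤ value q β x θ :=
  le_ciInf fun π => policyValue_nonneg q β π x θ

theorem value_le_one (q : PMF ℤ) (β : ℝ) (x : ℤ) {θ : ℝ} (hθ : θ ≤ 0) : value q β x θ ≤ 1 := by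
  obtain ⟨π⟩ := (inferInstance : Nonempty Policy)
  refine (ciInf_le ⟨0, ?_⟩ π).trans ?_
  · rintro _ ⟨π, rfl⟩
    exact policyValue_nonneg q β π x θ
  · have h := integral_mono (integrable_expScaled_totalDividends q β π x hθ)
      (integrable_const (1 : ℝ)) fun z => expScaled_le_one hθ _
    simpa [policyValue] using h

theorem exp_le_value {q : PMF ℤ} {β : ℝ} (hβ0 : 0 ≤ β) (hβ1 : β < 1)
    (hq : Integrable (fun k : ℤ => max (k : ℝ) 0) q.toMeasure) {x : ℤ} (hx : 0 ≤ x) {θ : ℝ}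
    (hθ : θ ≤ 0) :
    Real.exp (θ * (x + β / (1 - β) * ∫ k, max (k : ℝ) 0 ∂q.toMeasure)) ≤ value q β x θ :=
  le_ciInf fun π => exp_le_policyValue hβ0 hβ1 hq π hx hθ

theorem ite_value_mem_Icc (q : PMF ℤ) (β : ℝ) (x : ℤ) {θ : ℝ} (hθ : θ ≤ 0) (k : ℤ) :
    (if -x ≤ k then value q β (x + k) θ else 1) ∈ Set.Icc (0 : ℝ) 1 := by
  split_ifs
  · exact ⟨value_nonneg _ _ _ _, value_le_one _ _ _ hθ⟩
  · simp

theorem integrable_ite_value (q : PMF ℤ) (β : ℝ) (x : ℤ) {θ : ℝ} (hθ : θ ≤ 0) :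
    Integrable (fun k : ℤ => if -x ≤ k then value q β (x + k) θ else 1) q.toMeasure := by
  refine Integrable.of_bound (C := 1) Measurable.of_discrete.aestronglyMeasurable
    (Filter.Eventually.of_forall fun k => ?_)
  have h := ite_value_mem_Icc q β x hθ k
  rw [Real.norm_of_nonneg h.1]
  exact h.2

theorem G_eq_integral (q : PMF ℤ) (β : ℝ) (x : ℤ) {θ : ℝ} (hθ : θ ≤ 0) :
    G q β x θ = ∫ k, (if -x ≤ k then value q β (x + k) θ else 1) ∂q.toMeasure := by
  rw [PMF.integral_eq_tsum _ _ (integrable_ite_value q β x hθ), G]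
  simp only [smul_eq_mul, mul_comm]

theorem G_le_one (q : PMF ℤ) (β : ℝ) (x : ℤ) {θ : ℝ} (hθ : θ ≤ 0) : G q β x θ ≤ 1 := by
  rw [G_eq_integral q β x hθ]
  have h := integral_mono (integrable_ite_value q β x hθ) (integrable_const (1 : ℝ))
    fun k => (ite_value_mem_Icc q β x hθ k).2
  simpa using h

theorem exp_le_G {q : PMF ℤ} {β : ℝ} (hβ0 : 0 ≤ β) (hβ1 : β < 1)
    (hq : Integrable (fun k : ℤ => max (k : ℝ) 0) q.toMeasure) {x : ℤ} (hx : 0 ≤ x) {θ : ℝ}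
    (hθ : θ ≤ 0) :
    Real.exp (θ * (x + (∫ k, max (k : ℝ) 0 ∂q.toMeasure) / (1 - β))) ≤ G q β x θ := by
  set m := ∫ k, max (k : ℝ) 0 ∂q.toMeasure with hm
  have hm0 : 0 ≤ m := integral_nonneg fun k => le_max_right _ _
  have hb : 0 < 1 - β := by linarith
  have hx' : (0 : ℝ) ≤ x := by exact_mod_cast hx
  have hc0 : 0 ≤ β / (1 - β) * m := mul_nonneg (div_nonneg hβ0 hb.le) hm0
  -- In G the next income enters undiscounted, which adds m to the exponent.
  have hsplit : (x : ℝ) + m / (1 - β) = x + β / (1 - β) * m + m := by field_simp; ring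
  rw [G_eq_integral q β x hθ, hsplit]
  set c : ℝ := x + β / (1 - β) * m with hc
  have hcq : Integrable (fun k : ℤ => c + max (k : ℝ) 0) q.toMeasure :=
    (integrable_const c).add hq
  have hint : Integrable (fun k : ℤ => θ * (c + max (k : ℝ) 0 - (c + m))) q.toMeasure :=
    (hcq.sub (integrable_const _)).const_mul θ
  calc Real.exp (θ * (c + m))
      = ∫ k : ℤ, Real.exp (θ * (c + m)) * (1 + θ * (c + max (k : ℝ) 0 - (c + m)))
          ∂q.toMeasure := by
        rw [integral_const_mul, integral_add (integrable_const _) hint, integral_const_mul,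
          integral_sub hcq (integrable_const _),
          integral_add (integrable_const c) hq, ← hm]
        simp
    _ ≤ _ := by
        refine integral_mono (((integrable_const _).add hint).const_mul _)
          (integrable_ite_value q β x hθ) fun k => ?_
        refine (exp_tangent_le θ (c + m) _).trans ?_
        split_ifs with hk
        · refine le_trans ?_ (exp_le_value hβ0 hβ1 hq (by omega) hθ)
          refine Real.exp_le_exp.2 (mul_le_mul_of_nonpos_left ?_ hθ)
          push_cast
          linarith [le_max_left (k : ℝ) 0]
        · have : (0 : ℝ) ≤ max (k : ℝ) 0 := le_max_right _ _
          exact Real.exp_le_one_iff.2 (mul_nonpos_of_nonpos_of_nonneg hθ (by linarith))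

/-! ### Minimisers at large surplus -/

theorem objective_self_le_objective_zero {q : PMF ℤ} {β : ℝ} (hβ0 : 0 ≤ β) (hβ1 : β < 1)
    (hq : Integrable (fun k : ℤ => max (k : ℝ) 0) q.toMeasure) {θ : ℝ} (hθ : θ ≤ 0) {x : ℕ}
    (hx : β * (∫ k, max (k : ℝ) 0 ∂q.toMeasure) / (1 - β) ^ 2 ≤ x) :
    objective q β x θ x ≤ objective q β x θ 0 := by
  have hθβ : θ * β ≤ 0 := mul_nonpos_of_nonpos_of_nonneg hθ hβ0
  have hb : 0 < 1 - β := by linarith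
  have h0 := G_le_one q β ((x : ℤ) - (x : ℕ)) hθβ
  have h1 := exp_le_G hβ0 hβ1 hq (Int.natCast_nonneg x) hθβ
  -- After division by θ ≤ 0 this is x(1-β) ≥ βm/(1-β), the threshold `hx`.
  have h2 : θ * x ≤ θ * β * (((x : ℤ) : ℝ) + (∫ k, max (k : ℝ) 0 ∂q.toMeasure) / (1 - β)) := by
    rw [mul_assoc]
    refine mul_le_mul_of_nonpos_left ?_ hθ
    rw [div_le_iff₀ (by positivity)] at hx
    push_cast
    have : β * ((∫ k, max (k : ℝ) 0 ∂q.toMeasure) / (1 - β)) ≤ x * (1 - β) := by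
      rw [← mul_div_assoc, div_le_iff₀ hb]
      linarith
    linarith
  calc objective q β x θ x ≤ Real.exp (θ * x) * 1 :=
        mul_le_mul_of_nonneg_left h0 (Real.exp_nonneg _)
    _ ≤ G q β x (θ * β) := by
        rw [mul_one]
        exact (Real.exp_le_exp.2 h2).trans h1
    _ = objective q β x θ 0 := by simp [objective]

theorem mem_minimisers {q : PMF ℤ} {β θ : ℝ} {x a : ℕ} :
    a ∈ minimisers q β x θ ↔ a ≤ x ∧ ∀ b ≤ x, objective q β x θ a ≤ objective q β x θ b := by
  simp [minimisers, actions]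

theorem fstar_mem_minimisers (q : PMF ℤ) (β θ : ℝ) (x : ℕ) :
    fstar q β x θ ∈ minimisers q β x θ := by
  rw [fstar, if_pos (Int.natCast_nonneg x)]
  exact Finset.max'_mem _ _

theorem le_fstar {q : PMF ℤ} {β θ : ℝ} {x a : ℕ} (ha : a ∈ minimisers q β x θ) :
    a ≤ fstar q β x θ := by
  rw [fstar, if_pos (Int.natCast_nonneg x)]
  exact Finset.le_max' _ _ ha

theorem fstar_ne_zero {q : PMF ℤ} {β : ℝ} (hβ0 : 0 ≤ β) (hβ1 : β < 1)
    (hq : Integrable (fun k : ℤ => max (k : ℝ) 0) q.toMeasure) {θ : ℝ} (hθ : θ ≤ 0) {x : ℕ}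
    (hx : β * (∫ k, max (k : ℝ) 0 ∂q.toMeasure) / (1 - β) ^ 2 ≤ x) (hx0 : x ≠ 0) :
    fstar q β x θ ≠ 0 := by
  intro h
  have h0 := fstar_mem_minimisers q β θ x
  rw [h, mem_minimisers] at h0
  have hmem : x ∈ minimisers q β x θ := mem_minimisers.2
    ⟨le_rfl, fun b hb => (objective_self_le_objective_zero hβ0 hβ1 hq hθ hx).trans (h0.2 b hb)⟩
  have := le_fstar hmem
  omega

/-! ### Structure of the largest minimiser -/

/-- Paying the dividend `a + b` at once compares with paying `b` after `a`. -/
theorem objective_add (q : PMF ℤ) (β θ : ℝ) {x a : ℕ} (hax : a ≤ x) (b : ℕ) :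
    objective q β x θ (a + b) = Real.exp (θ * a) * objective q β ((x - a : ℕ) : ℤ) θ b := by
  unfold objective
  rw [← mul_assoc, ← Real.exp_add]
  push_cast [hax]
  ring_nf

theorem add_mem_minimisers_iff {q : PMF ℤ} {β θ : ℝ} {x b : ℕ} :
    fstar q β x θ + b ∈ minimisers q β x θ ↔
      b ∈ minimisers q β ((x - fstar q β x θ : ℕ) : ℤ) θ := by
  have ha := mem_minimisers.1 (fstar_mem_minimisers q β θ x)
  set a := fstar q β x θ
  rw [mem_minimisers, mem_minimisers]
  have hpos := Real.exp_pos (θ * a)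
  constructor
  · rintro ⟨h1, h2⟩
    refine ⟨by omega, fun c hc => ?_⟩
    have := h2 (a + c) (by omega)
    rwa [objective_add q β θ ha.1, objective_add q β θ ha.1, mul_le_mul_iff_right₀ hpos] at this
  · rintro ⟨h1, h2⟩
    refine ⟨by omega, fun c hc => le_trans ?_ (ha.2 c hc)⟩
    have h := objective_add q β θ ha.1 0
    rw [add_zero] at h
    rw [objective_add q β θ ha.1, h, mul_le_mul_iff_right₀ hpos]
    exact h2 0 (Nat.zero_le _)

/-- A further positive optimal payment could be merged with the first, contradicting its maximality.
-/
theorem fstar_sub_fstar (q : PMF ℤ) (β θ : ℝ) (x : ℕ) :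
    fstar q β ((x - fstar q β x θ : ℕ) : ℤ) θ = 0 := by
  have h := le_fstar (add_mem_minimisers_iff.2
    (fstar_mem_minimisers q β θ (x - fstar q β x θ)))
  omega

/-- If x - f*(x) < y, the optimal payment from x passes through y, and its remaining part is a
positive minimiser at y. -/
theorem le_sub_fstar {q : PMF ℤ} {β θ : ℝ} {x y : ℕ} (hyx : y ≤ x) (hy : fstar q β y θ = 0) :
    y ≤ x - fstar q β x θ := by
  by_contra! hlt
  have ha := mem_minimisers.1 (fstar_mem_minimisers q β θ x)
  set a := fstar q β x θ
  have hy0 := mem_minimisers.1 (fstar_mem_minimisers q β θ y)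
  rw [hy] at hy0
  have hmem : y - (x - a) ∈ minimisers q β y θ := by
    refine mem_minimisers.2 ⟨by omega, fun b hb => le_trans ?_ (hy0.2 b hb)⟩
    have h := ha.2 (x - y) (by omega)
    have h1 := objective_add q β θ (show x - y ≤ x by omega) (y - (x - a))
    have h2 := objective_add q β θ (show x - y ≤ x by omega) 0
    rw [show x - y + (y - (x - a)) = a by omega, show x - (x - y) = y by omega] at h1
    rw [add_zero, show x - (x - y) = y by omega] at h2
    rwa [h1, h2, mul_le_mul_iff_right₀ (Real.exp_pos _)] at h
  have := le_fstar hmem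
  omega

theorem fstar_eq_sub_of_xi_eq {q : PMF ℤ} {β θ : ℝ} {N x : ℕ} (hN : xi q β θ = N)
    (hx : N < x) : fstar q β x θ + N = x := by
  have hle {y : ℕ} (hy : fstar q β y θ = 0) : y ≤ N := by
    have : (y : ℕ∞) ≤ xi q β θ := le_iSup₂ (f := fun (x : ℕ) _ => (x : ℕ∞)) y hy
    rw [hN] at this
    exact_mod_cast this
  have h1 := hle (fstar_sub_fstar q β θ x)
  -- All zeros of f* are at most N < x, so each lies below the zero x - f*(x).
  have h2 : xi q β θ ≤ ((x - fstar q β x θ : ℕ) : ℕ∞) :=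
    iSup₂_le fun y hy => by exact_mod_cast le_sub_fstar ((hle hy).trans hx.le) hy
  rw [hN] at h2
  have h3 : N ≤ x - fstar q β x θ := by exact_mod_cast h2
  have h4 := (mem_minimisers.1 (fstar_mem_minimisers q β θ x)).1
  omega

theorem xi_le {q : PMF ℤ} {β : ℝ} (hβ0 : 0 ≤ β) (hβ1 : β < 1)
    (hq : Integrable (fun k : ℤ => max (k : ℝ) 0) q.toMeasure) {θ : ℝ} (hθ : θ ≤ 0) :
    xi q β θ ≤ (⌈β * (∫ k, max (k : ℝ) 0 ∂q.toMeasure) / (1 - β) ^ 2⌉₊ : ℕ) := by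
  refine iSup₂_le fun x hx => ?_
  by_contra! hlt
  have hlt' : ⌈β * (∫ k, max (k : ℝ) 0 ∂q.toMeasure) / (1 - β) ^ 2⌉₊ < x := by
    exact_mod_cast hlt
  exact fstar_ne_zero hβ0 hβ1 hq hθ (Nat.ceil_le.1 hlt'.le) (by omega) hx

end Dividend

theorem mainTheorem4 (q : PMF ℤ) (β γ : ℝ) (hβ : β ∈ Set.Ioo (0 : ℝ) 1) (hγ : γ < 0)
    (hA1 : Integrable (fun k : ℤ => max (k : ℝ) 0) q.toMeasure)
    (hA2 : 0 < q.toMeasure {k : ℤ | k < 0}) :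
    (⨆ θ ∈ Set.Ico γ 0, Dividend.xi q β θ) < ⊤ ∧
      ∀ θ ∈ Set.Ico γ 0, ∀ x : ℤ, ((Dividend.xi q β θ).toNat : ℤ) < x →
        (Dividend.fstar q β x θ : ℤ) = x - ((Dividend.xi q β θ).toNat : ℤ) := by
  refine ⟨lt_of_le_of_lt (iSup₂_le fun θ hθ => Dividend.xi_le hβ.1.le hβ.2 hA1 hθ.2.le)
    (ENat.natCast_lt_top _), fun θ hθ x hx => ?_⟩
  have hfin : Dividend.xi q β θ ≠ ⊤ :=
    ((Dividend.xi_le hβ.1.le hβ.2 hA1 hθ.2.le).trans_lt (ENat.natCast_lt_top _)).ne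
  lift x to ℕ using by omega
  have h := Dividend.fstar_eq_sub_of_xi_eq (ENat.natCast_toNat hfin).symm (by exact_mod_cast hx)
  omega
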